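/- Let $k\ge 2$, $r\ge 1$ and $\alpha\in[0,rk-1]$ be integers, and let $m\in[1,k]$ be the integer with $(m-1)r\le\alpha<mr$. Let $\mathcal{A}$ be a finite sequence of $rk$ integers made up of $k$ distinct integers, each appearing exactly $r$ times; the order of the terms is irrelevant. Let $\Sigma_\alpha(\mathcal{A})$ be the set of all sums of the terms of subsequences of $\mathcal{A}$ that have at least $\alpha$ terms (the empty subsequence has sum $0$). Let $-\mathcal{A}$ be the sequence of the negatives of the terms of $\mathcal{A}$, let $\mathcal{A}\cap(-\mathcal{A})$ be the sequence of the terms common to both, counted with multiplicity, and let $(0)_r$ be the sequence consisting of $r$ copies of $0$. If $\mathcal{A}\cap(-\mathcal{A})=\emptyset$, then $$|\Sigma_\alpha(\mathcal{A})|\ \ge\ r\left(\frac{k(k+1)}{2}-\frac{m(m+1)}{2}\right)+m(mr-\alpha)+1 .$$ If $\mathcal{A}\cap(-\mathcal{A})=(0)_r$, then $$|\Sigma_\alpha(\mathcal{A})|\ \ge\ r\left(\frac{k(k-1)}{2}-\frac{m(m-1)}{2}\right)+(m-1)(mr-\alpha)+1 .$$ Both bounds are optimal: for all $k,r,\alpha,m$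 as above, the sequence $[1,k]_r$, in which each of $1,2,\dots,k$ appears exactly $r$ times, satisfies the first condition and attains equality in the first bound, and the sequence $[0,k-1]_r$, in which each of $0,1,\dots,k-1$ appears exactly $r$ times, satisfies the second condition and attains equality in the second bound. -/

import Mathlib

namespace SubsequenceSum

/-- A finite sequence of integers, considered up to the order of its terms, is a multiset of
integers, and its subsequences are its sub-multisets. `IsRepeated k r 𝒜` says that `𝒜` is made up
of exactly `k` distinct integers, each of which appears exactly `r` times in `𝒜`. -/
def IsRepeated (k r : ℕ) (𝒜 : Multiset ℤ) : Prop :=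
  𝒜.toFinset.card = k ∧ ∀ a ∈ 𝒜, 𝒜.count a = r

/-- The sequence `-𝒜` of the negatives of the terms of `𝒜`. -/
def negSeq (𝒜 : Multiset ℤ) : Multiset ℤ := 𝒜.map fun a => -a

/-- The sequence `[a, b]_r = (a, a + 1, …, b)_r`, each term repeated `r` times. -/
noncomputable def interval (a b : ℤ) (r : ℕ) : Multiset ℤ := r • (Finset.Icc a b).val

/-- `Σ_α(𝒜)`: the set of sums of the subsequences of `𝒜` having at least `α` terms. -/
def subseqSums (α : ℕ) (𝒜 : Multiset ℤ) : Finset ℤ :=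
  ((𝒜.powerset.filter fun ℬ => α ≤ ℬ.card).map Multiset.sum).toFinset

theorem mem_subseqSums {α : ℕ} {𝒜 : Multiset ℤ} {s : ℤ} :
    s ∈ subseqSums α 𝒜 ↔ ∃ ℬ : Multiset ℤ, ℬ ≤ 𝒜 ∧ α ≤ ℬ.card ∧ ℬ.sum = s := by
  simp [subseqSums, and_assoc]

/-- An `IsRepeated k r` sequence has `r * k` terms. -/
theorem IsRepeated.card_eq {k r : ℕ} {𝒜 : Multiset ℤ} (h : IsRepeated k r 𝒜) :
    𝒜.card = r * k := by
  rw [← Multiset.toFinset_sum_count_eq,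
    Finset.sum_congr rfl fun a ha => h.2 a (Multiset.mem_toFinset.1 ha),
    Finset.sum_const, h.1, smul_eq_mul, mul_comm]

end SubsequenceSum

/-! A repeated sequence is `r • A.val` for a set `A` of size `k`. With `m = μ + 1`, write `α = μ * r
+ s` and `r = s + t`: asking for `μ + 1` terms from each of `s` copies of `A` and `μ` from each of
the other `t` gives `α` terms. Since `|X + Y| ≥ |X| + |Y| - 1` in the integers,
`card_subseqSums_add_nsmul` reduces the lower bounds to `r = 1`.

There, complementation turns "at least `m`" into "at most `n = k - m`", and
`le_card_boundedSubsetSums` inducts on `k` by removing the element `c` of largest absolute value,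
positive up to reflection. Restoring `c` creates sums above all old ones: `n` of them if `m` also
grows, `k` if `n` grows, for the new size `k`. A zero term is removed beforehand, since adjoining it
costs nothing.

For intervals, a threshold argument confines the sums to an integer interval of exactly the required
length. -/

namespace SubsequenceSum

open Finset
open scoped Pointwise

/-! ### Sums of at most `n` elements of a set -/

/-- Sums of the subsets of `A` having at most `n` elements. -/
def boundedSubsetSums (n : ℕ) (A : Finset ℤ) : Finset ℤ :=
  (A.powerset.filter fun B => B.card ≤ n).image fun B => ∑ b ∈ B, b

theorem mem_boundedSubsetSums {n : ℕ} {A : Finset ℤ} {s : ℤ} :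
    s ∈ boundedSubsetSums n A ↔ ∃ B ⊆ A, B.card ≤ n ∧ ∑ b ∈ B, b = s := by
  simp [boundedSubsetSums, and_assoc]

theorem boundedSubsetSums_mono {n n' : ℕ} {A A' : Finset ℤ} (hn : n ≤ n') (hA : A ⊆ A') :
    boundedSubsetSums n A ⊆ boundedSubsetSums n' A' := by
  intro s hs
  obtain ⟨B, hB, hc, rfl⟩ := mem_boundedSubsetSums.1 hs
  exact mem_boundedSubsetSums.2 ⟨B, hB.trans hA, hc.trans hn, rfl⟩

theorem card_boundedSubsetSums_neg (n : ℕ) (A : Finset ℤ) :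
    (boundedSubsetSums n (-A)).card = (boundedSubsetSums n A).card := by
  have key : ∀ A : Finset ℤ, (boundedSubsetSums n A).card ≤ (boundedSubsetSums n (-A)).card := by
    intro A
    refine card_le_card_of_injOn (fun x => -x) ?_ neg_injective.injOn
    intro s hs
    obtain ⟨B, hB, hc, rfl⟩ := mem_boundedSubsetSums.1 hs
    refine mem_boundedSubsetSums.2 ⟨-B, neg_subset_neg hB, by simpa using hc, ?_⟩
    rw [← image_neg_eq_neg, sum_image neg_injective.injOn, sum_neg_distrib]
  exact le_antisymm (by simpa using key (-A)) (key A)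

/-- Elements of `Z` lying above a subset `X` of `Z` are new. -/
theorem card_add_card_le_of_lt {X Y Z : Finset ℤ} {M : ℤ} (hX : X ⊆ Z) (hY : Y ⊆ Z)
    (hXM : ∀ x ∈ X, x ≤ M) (hYM : ∀ y ∈ Y, M < y) : X.card + Y.card ≤ Z.card := by
  rw [← card_union_of_disjoint]
  · exact card_le_card (union_subset hX hY)
  · rw [disjoint_left]
    intro x hx hy
    exact absurd (hXM x hx) (not_le.2 (hYM x hy))

/-- If `A` has at least `n - 1` positive elements, adjoining an element that dominates `A` creates
`n` new sums of at most `n` elements. -/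
theorem card_boundedSubsetSums_add_le {n : ℕ} {A : Finset ℤ} {c : ℤ} (hc : 0 < c)
    (hA : ∀ b ∈ A, |b| < c) (hp : n ≤ (A.filter (0 < ·)).card + 1) :
    (boundedSubsetSums n A).card + n ≤ (boundedSubsetSums n (insert c A)).card := by
  have hcA : c ∉ A := fun h => by simpa [abs_of_pos hc] using hA c h
  obtain ⟨T, hT, hmax⟩ := exists_max_image (A.powerset.filter fun B => B.card ≤ n)
    (fun B => ∑ b ∈ B, b) ⟨∅, by simp⟩
  simp only [mem_filter, mem_powerset] at hT hmax
  obtain ⟨hTA, hTn⟩ := hT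
  -- The new sums are `∑ T + c - u`. If `T` is full, `c` replaces some `u ∈ T`; otherwise `c` may
  -- also be adjoined outright (`u = 0`), and maximality puts every positive element in `T`.
  obtain ⟨U, hUn, hU⟩ : ∃ U : Finset ℤ, n ≤ U.card ∧ ∀ u ∈ U, u ∈ T ∨ u = 0 ∧ T.card < n := by
    rcases hTn.eq_or_lt with h | h
    · exact ⟨T, h.ge, fun u hu => Or.inl hu⟩
    · refine ⟨insert 0 (A.filter (0 < ·)), by rwa [card_insert_of_notMem (by simp)], ?_⟩
      intro u hu
      rcases mem_insert.1 hu with rfl | hu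
      · exact Or.inr ⟨rfl, h⟩
      · obtain ⟨huA, hu0⟩ := mem_filter.1 hu
        by_contra hcon
        have huT : u ∉ T := fun h' => hcon (Or.inl h')
        have := hmax (insert u T)
          ⟨insert_subset huA hTA, by rw [card_insert_of_notMem huT]; omega⟩
        rw [sum_insert huT] at this
        omega
  have hinj : Function.Injective fun u : ℤ => ∑ b ∈ T, b + c - u := sub_right_injective
  calc (boundedSubsetSums n A).card + n
      ≤ (boundedSubsetSums n A).card + (U.image fun u => ∑ b ∈ T, b + c - u).card := by
        rw [card_image_of_injective _ hinj]; omega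
    _ ≤ _ := by
      refine card_add_card_le_of_lt (M := ∑ b ∈ T, b)
        (boundedSubsetSums_mono le_rfl (subset_insert c A)) ?_ ?_ ?_
      · intro s hs
        obtain ⟨u, hu, rfl⟩ := mem_image.1 hs
        rw [mem_boundedSubsetSums]
        rcases hU u hu with hu | ⟨rfl, h⟩
        · have hcT : c ∉ T.erase u := fun h => hcA (hTA (mem_of_mem_erase h))
          refine ⟨insert c (T.erase u), insert_subset_insert _ ((erase_subset u T).trans hTA), ?_, ?_⟩
          · rw [card_insert_of_notMem hcT, card_erase_add_one hu]
            exact hTn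
          · rw [sum_insert hcT, ← add_sum_erase T (fun b => b) hu]
            ring
        · have hcT : c ∉ T := fun h => hcA (hTA h)
          refine ⟨insert c T, insert_subset_insert _ hTA, ?_, ?_⟩
          · rw [card_insert_of_notMem hcT]
            exact h
          · rw [sum_insert hcT]
            ring
      · intro s hs
        obtain ⟨B, hB, hBn, rfl⟩ := mem_boundedSubsetSums.1 hs
        exact hmax B ⟨hB, hBn⟩
      · intro s hs
        obtain ⟨u, hu, rfl⟩ := mem_image.1 hs
        have : u < c := by
          rcases hU u hu with hu | ⟨rfl, -⟩
          · exact (abs_lt.1 (hA u (hTA hu))).2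
          · exact hc
        omega

theorem sum_le_sum_filter_pos {A B : Finset ℤ} (h : B ⊆ A) :
    ∑ b ∈ B, b ≤ ∑ b ∈ A.filter (0 < ·), b :=
  calc ∑ b ∈ B, b ≤ ∑ b ∈ B, max b 0 := sum_le_sum fun _ _ => le_max_left _ _
    _ ≤ ∑ b ∈ A, max b 0 := sum_le_sum_of_subset_of_nonneg h fun _ _ _ => le_max_right _ _
    _ = _ := by
      rw [sum_filter]
      refine sum_congr rfl fun b _ => ?_
      split_ifs <;> omega

/-- If `A` has few positive elements, adjoining an element that dominates `A` and allowing one more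
summand creates `#A + 1` new sums. -/
theorem card_boundedSubsetSums_succ_add_le {n : ℕ} {A : Finset ℤ} {c : ℤ} (hc : 0 < c)
    (hA : ∀ b ∈ A, |b| < c) (hneg : ∀ a ∈ A, -a ∉ A) (hp : (A.filter (0 < ·)).card ≤ n)
    (hp' : ∀ b ∈ A, b < 0 → (A.filter (0 < ·)).card < n) :
    (boundedSubsetSums n A).card + (A.card + 1) ≤
      (boundedSubsetSums (n + 1) (insert c A)).card := by
  have hcA : c ∉ A := fun h => by simpa [abs_of_pos hc] using hA c h
  have h0 : (0 : ℤ) ∉ A := fun h => hneg 0 h (by simpa using h)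
  set P := A.filter (0 < ·) with hP
  have hPA : P ⊆ A := filter_subset _ _
  have hcP : c ∉ P := fun h => hcA (hPA h)
  -- Deleting a positive `b` from `insert c P` or adjoining a negative one both lower the sum by
  -- `|b|`; these decrements differ because no two elements are opposite.
  have hcard : (insert 0 (A.image fun b => |b|)).card = A.card + 1 := by
    rw [card_insert_of_notMem, card_image_of_injOn]
    · intro a ha b hb hab
      rcases abs_eq_abs.1 hab with h | h
      · exact h
      · exact absurd (h ▸ ha) (hneg b hb)
    · intro h
      obtain ⟨b, hb, hb0⟩ := mem_image.1 h
      exact h0 (abs_eq_zero.1 hb0 ▸ hb)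
  have hinj : Function.Injective fun u : ℤ => ∑ b ∈ P, b + c - u := sub_right_injective
  rw [← hcard, ← card_image_of_injective (insert 0 (A.image fun b => |b|)) hinj]
  refine card_add_card_le_of_lt (M := ∑ b ∈ P, b)
    (boundedSubsetSums_mono n.le_succ (subset_insert c A)) ?_ ?_ ?_
  · intro s hs
    obtain ⟨u, hu, rfl⟩ := mem_image.1 hs
    rw [mem_boundedSubsetSums]
    rcases mem_insert.1 hu with rfl | hu
    · refine ⟨insert c P, insert_subset_insert _ hPA, ?_, ?_⟩
      · rw [card_insert_of_notMem hcP]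
        omega
      · rw [sum_insert hcP]
        ring
    · obtain ⟨b, hb, rfl⟩ := mem_image.1 hu
      rcases lt_trichotomy b 0 with hb0 | rfl | hb0
      · have hbP : b ∉ P := fun h => absurd (mem_filter.1 h).2 (not_lt.2 hb0.le)
        have hcbP : c ∉ insert b P := fun h => hcA (insert_subset hb hPA h)
        refine ⟨insert c (insert b P), insert_subset_insert _ (insert_subset hb hPA), ?_, ?_⟩
        · rw [card_insert_of_notMem hcbP, card_insert_of_notMem hbP]
          have := hp' b hb hb0
          omega
        · rw [sum_insert hcbP, sum_insert hbP, abs_of_neg hb0]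
          ring
      · exact absurd hb h0
      · have hbP : b ∈ P := mem_filter.2 ⟨hb, hb0⟩
        have hcbP : c ∉ P.erase b := fun h => hcP (mem_of_mem_erase h)
        refine ⟨insert c (P.erase b), insert_subset_insert _ ((erase_subset b P).trans hPA), ?_, ?_⟩
        · rw [card_insert_of_notMem hcbP, card_erase_add_one hbP]
          omega
        · rw [sum_insert hcbP, ← add_sum_erase P (fun b => b) hbP, abs_of_pos hb0]
          ring
  · intro s hs
    obtain ⟨B, hB, hBn, rfl⟩ := mem_boundedSubsetSums.1 hs
    exact sum_le_sum_filter_pos hB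
  · intro s hs
    obtain ⟨u, hu, rfl⟩ := mem_image.1 hs
    have : u < c := by
      rcases mem_insert.1 hu with rfl | hu
      · exact hc
      · obtain ⟨b, hb, rfl⟩ := mem_image.1 hu
        exact hA b hb
    omega

/-- A set of `n + m` integers, no two of them opposite, has at least
`(n + m)(n + m + 1)/2 - m(m + 1)/2 + 1` sums of at most `n` elements. -/
theorem le_card_boundedSubsetSums {k : ℕ} : ∀ {A : Finset ℤ} {n m : ℕ}, A.card = k → n + m = k →
    (∀ a ∈ A, -a ∉ A) →
    k * (k + 1) + 2 ≤ 2 * (boundedSubsetSums n A).card + m * (m + 1) := by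
  induction k with
  | zero =>
    intro A n m hA hnm hneg
    have : 0 < (boundedSubsetSums n A).card :=
      card_pos.2 ⟨0, mem_boundedSubsetSums.2 ⟨∅, by simp⟩⟩
    omega
  | succ k ih =>
    intro A n m hA hnm hneg
    have hne : A.Nonempty := card_pos.1 (by omega)
    have key : ∀ A : Finset ℤ, A.card = k + 1 → (∀ a ∈ A, -a ∉ A) → ∀ c ∈ A, 0 < c →
        (∀ b ∈ A, |b| ≤ |c|) →
        (k + 1) * (k + 1 + 1) + 2 ≤ 2 * (boundedSubsetSums n A).card + m * (m + 1) := by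
      intro A hA hneg c hcA hc hmax
      have hB : (A.erase c).card = k := by rw [card_erase_of_mem hcA, hA]; rfl
      have hBneg : ∀ a ∈ A.erase c, -a ∉ A.erase c := fun a ha h =>
        hneg a (mem_of_mem_erase ha) (mem_of_mem_erase h)
      have hBc : ∀ b ∈ A.erase c, |b| < c := by
        intro b hb
        obtain ⟨hbc, hbA⟩ := mem_erase.1 hb
        refine lt_of_le_of_ne ((hmax b hbA).trans_eq (abs_of_pos hc)) fun h => ?_
        rcases (abs_eq hc.le).1 h with h | h
        · exact hbc h
        · exact hneg c hcA (h ▸ hbA)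
      have hins : insert c (A.erase c) = A := insert_erase hcA
      -- Otherwise either `m = 0`, so `n = k + 1` and no size limit binds, or the positive elements
      -- number less than `n - 1`; both allow lowering `n`.
      by_cases hcase : 1 ≤ m ∧ n ≤ ((A.erase c).filter (0 < ·)).card + 1
      · have h1 := card_boundedSubsetSums_add_le hc hBc hcase.2
        obtain ⟨m, rfl⟩ := Nat.exists_eq_add_of_le' hcase.1
        have h2 := ih (n := n) (m := m) hB (by omega) hBneg
        rw [hins] at h1
        nlinarith
      · have hlt : ∀ b ∈ A.erase c, b < 0 → ((A.erase c).filter (0 < ·)).card < k := by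
          intro b hb hb0
          rw [← hB]
          exact card_lt_card (filter_ssubset.2 ⟨b, hb, not_lt.2 hb0.le⟩)
        have hle : ((A.erase c).filter (0 < ·)).card ≤ k := hB ▸ card_filter_le _ _
        obtain ⟨n, rfl⟩ : ∃ n', n = n' + 1 := ⟨n - 1, by omega⟩
        have h1 := card_boundedSubsetSums_succ_add_le (n := n) hc hBc hBneg (by omega)
          (fun b hb hb0 => by have := hlt b hb hb0; omega)
        have h2 := ih (n := n) (m := m) hB (by omega) hBneg
        rw [hins, hB] at h1
        nlinarith
    obtain ⟨c, hcA, hmax⟩ := exists_max_image A (fun b => |b|) hne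
    rcases lt_trichotomy c 0 with hc | rfl | hc
    · rw [← card_boundedSubsetSums_neg]
      refine key (-A) (by simpa using hA) ?_ (-c) (by simpa using hcA) (by omega) ?_
      · intro a ha h
        exact hneg _ (mem_neg'.1 h) (by simpa using ha)
      · intro b hb
        simpa using hmax (-b) (mem_neg'.1 hb)
    · exact absurd (by simpa using hcA) (hneg 0 hcA)
    · exact key A hA hneg c hcA hc hmax

/-! ### Sumsets of copies of a sequence -/

theorem subseqSums_nonempty {α : ℕ} {𝒜 : Multiset ℤ} (h : α ≤ 𝒜.card) :
    (subseqSums α 𝒜).Nonempty :=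
  ⟨_, mem_subseqSums.2 ⟨𝒜, le_rfl, h, rfl⟩⟩

theorem subseqSums_add_subset (α β : ℕ) (𝒜 ℬ : Multiset ℤ) :
    subseqSums α 𝒜 + subseqSums β ℬ ⊆ subseqSums (α + β) (𝒜 + ℬ) := by
  intro s hs
  obtain ⟨x, hx, y, hy, rfl⟩ := mem_add.1 hs
  obtain ⟨𝒞, h𝒞, hα, rfl⟩ := mem_subseqSums.1 hx
  obtain ⟨𝒟, h𝒟, hβ, rfl⟩ := mem_subseqSums.1 hy
  exact mem_subseqSums.2 ⟨𝒞 + 𝒟, add_le_add h𝒞 h𝒟, by rw [Multiset.card_add]; omega, by simp⟩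

theorem card_subseqSums_add {α β : ℕ} {𝒜 ℬ : Multiset ℤ} (hα : α ≤ 𝒜.card) (hβ : β ≤ ℬ.card) :
    (subseqSums α 𝒜).card + (subseqSums β ℬ).card ≤ (subseqSums (α + β) (𝒜 + ℬ)).card + 1 := by
  have h1 := cauchy_davenport_add_of_linearOrder_isCancelAdd (subseqSums_nonempty hα)
    (subseqSums_nonempty hβ)
  have h2 := card_le_card (subseqSums_add_subset α β 𝒜 ℬ)
  omega

theorem card_subseqSums_nsmul {α : ℕ} {𝒜 : Multiset ℤ} (hα : α ≤ 𝒜.card) (j : ℕ) :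
    j * (subseqSums α 𝒜).card + 1 ≤ (subseqSums (j * α) (j • 𝒜)).card + j := by
  induction j with
  | zero =>
    have := (subseqSums_nonempty (Nat.zero_le (0 : Multiset ℤ).card)).card_pos
    simp only [zero_mul, zero_smul]
    omega
  | succ j ih =>
    have h := card_subseqSums_add (α := j * α) (𝒜 := j • 𝒜)
      (by rw [Multiset.card_nsmul]; exact Nat.mul_le_mul_left j hα) hα
    rw [add_mul, add_mul, add_smul, one_mul, one_smul, one_mul]
    omega

theorem card_subseqSums_add_nsmul {μ : ℕ} {𝒜 : Multiset ℤ} (hμ : μ + 1 ≤ 𝒜.card) (s t : ℕ) :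
    s * (subseqSums (μ + 1) 𝒜).card + t * (subseqSums μ 𝒜).card + 1 ≤
      (subseqSums (s * (μ + 1) + t * μ) ((s + t) • 𝒜)).card + (s + t) := by
  have h1 := card_subseqSums_nsmul hμ s
  have h2 := card_subseqSums_nsmul (α := μ) (𝒜 := 𝒜) (by omega) t
  have h3 := card_subseqSums_add (α := s * (μ + 1)) (β := t * μ) (𝒜 := s • 𝒜) (ℬ := t • 𝒜)
    (by rw [Multiset.card_nsmul]; exact Nat.mul_le_mul_left s hμ)
    (by rw [Multiset.card_nsmul]; exact Nat.mul_le_mul_left t (by omega))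
  rw [add_smul]
  omega

/-! ### Lower bounds for sets, then for repeated sequences -/

/-- Complementation turns sums of at most `n` elements into sums of at least `#A - n` elements. -/
theorem card_boundedSubsetSums_le {n m : ℕ} {A : Finset ℤ} (h : n + m = A.card) :
    (boundedSubsetSums n A).card ≤ (subseqSums m A.val).card := by
  refine card_le_card_of_injOn (fun x => ∑ b ∈ A, b - x) ?_ sub_right_injective.injOn
  intro s hs
  obtain ⟨B, hB, hc, rfl⟩ := mem_boundedSubsetSums.1 hs
  refine mem_subseqSums.2 ⟨(A \ B).val, val_le_iff.2 sdiff_subset, ?_, ?_⟩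
  · have := card_sdiff_add_card_eq_card hB
    rw [card_val]
    omega
  · rw [sum_val, ← sum_sdiff hB]
    simp

theorem le_card_subseqSums_val {m : ℕ} {A : Finset ℤ} (hneg : ∀ a ∈ A, -a ∉ A)
    (hm : m ≤ A.card) :
    A.card * (A.card + 1) + 2 ≤ 2 * (subseqSums m A.val).card + m * (m + 1) := by
  obtain ⟨n, hn⟩ := Nat.exists_eq_add_of_le' hm
  have h1 := le_card_boundedSubsetSums rfl hn.symm hneg
  have h2 := card_boundedSubsetSums_le hn.symm
  omega

theorem le_card_subseqSums_val_of_zero_mem {m : ℕ} {A : Finset ℤ} (h0 : 0 ∈ A)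
    (hneg : ∀ a ∈ A, a ≠ 0 → -a ∉ A) (hm : m ≤ A.card) :
    (A.card - 1) * A.card + 2 ≤ 2 * (subseqSums m A.val).card + (m - 1) * m := by
  have hcard : (A.erase 0).card = A.card - 1 := card_erase_of_mem h0
  have hpos : 0 < A.card := card_pos.2 ⟨0, h0⟩
  have h1 := le_card_subseqSums_val (m := m - 1) (A := A.erase 0)
    (fun a ha h => hneg a (mem_of_mem_erase ha) (ne_of_mem_erase ha) (mem_of_mem_erase h))
    (by omega)
  have h2 : (subseqSums (m - 1) (A.erase 0).val).card ≤ (subseqSums m A.val).card := by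
    refine card_le_card fun s hs => ?_
    obtain ⟨ℬ, hℬ, hc, rfl⟩ := mem_subseqSums.1 hs
    -- Adjoining `0` gains a term without changing the sum; at `m = 0` the truncated `m - 1` is
    -- harmless.
    refine mem_subseqSums.2 ⟨0 ::ₘ ℬ, ?_, ?_, by simp⟩
    · rw [← insert_erase h0, insert_val_of_notMem (notMem_erase 0 A)]
      exact (Multiset.cons_le_cons_iff 0).2 (by simpa using hℬ)
    · rw [Multiset.card_cons]
      omega
  rw [hcard, Nat.sub_add_cancel hpos] at h1
  have h3 : (m - 1) * (m - 1 + 1) = (m - 1) * m := by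
    cases m <;> simp
  omega

theorem IsRepeated.eq_nsmul {k r : ℕ} {𝒜 : Multiset ℤ} (h : IsRepeated k r 𝒜) :
    𝒜 = r • 𝒜.toFinset.val := by
  ext a
  rw [Multiset.count_nsmul, Multiset.toFinset_val, Multiset.count_dedup]
  split_ifs with ha
  · rw [h.2 a ha, mul_one]
  · rw [Multiset.count_eq_zero.2 ha, mul_zero]

theorem mem_negSeq {a : ℤ} {𝒜 : Multiset ℤ} : a ∈ negSeq 𝒜 ↔ -a ∈ 𝒜 := by
  simp only [negSeq, Multiset.mem_map]
  exact ⟨by rintro ⟨b, hb, rfl⟩; simpa using hb, fun h => ⟨-a, h, neg_neg a⟩⟩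

theorem le_card_subseqSums {k r α m : ℕ} {𝒜 : Multiset ℤ} (h𝒜 : IsRepeated k r 𝒜)
    (hneg : 𝒜 ∩ negSeq 𝒜 = 0) (hm1 : 1 ≤ m) (hmk : m ≤ k) (hmα : (m - 1) * r ≤ α)
    (hαm : α < m * r) :
    (r : ℚ) * ((k : ℚ) * (k + 1) / 2 - (m : ℚ) * (m + 1) / 2) + (m : ℚ) * ((m : ℚ) * r - α) + 1 ≤
      ((subseqSums α 𝒜).card : ℚ) := by
  obtain ⟨μ, rfl⟩ := Nat.exists_eq_add_of_le' hm1
  rw [Nat.add_sub_cancel] at hmα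
  -- Here `s` copies use the bound for `μ + 1` and `t = r - s` copies the one for `μ`.
  obtain ⟨s, rfl⟩ := Nat.exists_eq_add_of_le hmα
  obtain ⟨t, rfl⟩ : ∃ t, r = s + t := ⟨r - s, by rw [add_mul] at hαm; omega⟩
  have hcard := h𝒜.1
  have hA : ∀ a ∈ 𝒜.toFinset, -a ∉ 𝒜.toFinset := by
    intro a ha ha'
    rw [Multiset.mem_toFinset] at ha ha'
    have := Multiset.mem_inter.2 ⟨ha, mem_negSeq.2 ha'⟩
    rw [hneg] at this
    exact Multiset.notMem_zero a this
  have h1 := le_card_subseqSums_val (m := μ + 1) hA (by omega)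
  have h0 := le_card_subseqSums_val (m := μ) hA (by omega)
  have h := card_subseqSums_add_nsmul (μ := μ) (𝒜 := 𝒜.toFinset.val) (by rw [card_val]; omega) s t
  rw [← h𝒜.eq_nsmul, show s * (μ + 1) + t * μ = μ * (s + t) + s by ring] at h
  rw [hcard] at h1 h0
  have h1' := Nat.mul_le_mul_left s h1
  have h0' := Nat.mul_le_mul_left t h0
  qify at h1' h0' h
  push_cast
  linarith

theorem le_card_subseqSums_of_zero {k r α m : ℕ} {𝒜 : Multiset ℤ} (h𝒜 : IsRepeated k r 𝒜)
    (hneg : 𝒜 ∩ negSeq 𝒜 = Multiset.replicate r 0) (hr : 1 ≤ r) (hm1 : 1 ≤ m) (hmk : m ≤ k)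
    (hmα : (m - 1) * r ≤ α) (hαm : α < m * r) :
    (r : ℚ) * ((k : ℚ) * (k - 1) / 2 - (m : ℚ) * (m - 1) / 2)
        + ((m : ℚ) - 1) * ((m : ℚ) * r - α) + 1 ≤ ((subseqSums α 𝒜).card : ℚ) := by
  have hmem0 : (0 : ℤ) ∈ 𝒜 ∩ negSeq 𝒜 := by
    rw [hneg]
    exact Multiset.mem_replicate.2 ⟨by omega, rfl⟩
  obtain ⟨μ, rfl⟩ := Nat.exists_eq_add_of_le' hm1
  rw [Nat.add_sub_cancel] at hmα
  obtain ⟨s, rfl⟩ := Nat.exists_eq_add_of_le hmα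
  obtain ⟨t, rfl⟩ : ∃ t, r = s + t := ⟨r - s, by rw [add_mul] at hαm; omega⟩
  have hcard := h𝒜.1
  have hA : ∀ a ∈ 𝒜.toFinset, a ≠ 0 → -a ∉ 𝒜.toFinset := by
    intro a ha ha0 ha'
    rw [Multiset.mem_toFinset] at ha ha'
    have := Multiset.mem_inter.2 ⟨ha, mem_negSeq.2 ha'⟩
    rw [hneg] at this
    exact ha0 (Multiset.eq_of_mem_replicate this)
  have hA0 : 0 ∈ 𝒜.toFinset := Multiset.mem_toFinset.2 (Multiset.mem_inter.1 hmem0).1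
  have h1 := le_card_subseqSums_val_of_zero_mem (m := μ + 1) hA0 hA (by omega)
  have h0 := le_card_subseqSums_val_of_zero_mem (m := μ) hA0 hA (by omega)
  have h := card_subseqSums_add_nsmul (μ := μ) (𝒜 := 𝒜.toFinset.val) (by rw [card_val]; omega) s t
  rw [← h𝒜.eq_nsmul, show s * (μ + 1) + t * μ = μ * (s + t) + s by ring] at h
  rw [hcard] at h1 h0
  have h1' := Nat.mul_le_mul_left s h1
  have h0' := Nat.mul_le_mul_left t h0
  -- At `μ = 0` the factor `μ` hides the truncation.
  have hμ : (((μ - 1) * μ : ℕ) : ℚ) = (μ - 1) * μ := by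
    cases μ <;> simp
  obtain ⟨l, rfl⟩ := Nat.exists_eq_add_of_le' (hm1.trans hmk)
  rw [Nat.add_sub_cancel] at h1' h0'
  rw [Nat.add_sub_cancel] at h1'
  have e1 : ((s * (l * (l + 1) + 2) : ℕ) : ℚ) ≤ _ := Nat.cast_le.2 h1'
  have e0 : ((t * (l * (l + 1) + 2) : ℕ) : ℚ) ≤ _ := Nat.cast_le.2 h0'
  rw [Nat.cast_mul t (2 * _ + _), Nat.cast_add (2 * _), hμ] at e0
  qify at h
  push_cast at e1 e0 ⊢
  linarith

/-! ### Upper bound and optimality for intervals -/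

theorem sum_map_le_of_le {𝒜 ℬ : Multiset ℤ} {f : ℤ → ℤ} (h : ℬ ≤ 𝒜) (hf : ∀ a ∈ 𝒜, 0 ≤ f a) :
    (ℬ.map f).sum ≤ (𝒜.map f).sum := by
  obtain ⟨𝒞, rfl⟩ := Multiset.le_iff_exists_add.1 h
  rw [Multiset.map_add, Multiset.sum_add, le_add_iff_nonneg_right]
  refine Multiset.sum_nonneg fun x hx => ?_
  obtain ⟨a, ha, rfl⟩ := Multiset.mem_map.1 hx
  exact hf a (Multiset.mem_add.2 (Or.inr ha))

theorem sum_map_nsmul_val (r : ℕ) (A : Finset ℤ) (f : ℤ → ℤ) :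
    ((r • A.val).map f).sum = r * ∑ a ∈ A, f a := by
  rw [Multiset.map_nsmul, Multiset.sum_nsmul, nsmul_eq_mul]
  rfl

/-- Comparing all terms with a threshold `t` bounds the sums of at least `α` terms from below. -/
theorem subseqSums_subset_Icc {r α : ℕ} {A : Finset ℤ} {t : ℤ} (hA : ∀ a ∈ A, 0 ≤ a) (ht : 0 ≤ t) :
    subseqSums α (r • A.val) ⊆
      Icc (t * α - r * ∑ a ∈ A, max (t - a) 0) (r * ∑ a ∈ A, a) := by
  intro s hs
  obtain ⟨ℬ, hℬ, hc, rfl⟩ := mem_subseqSums.1 hs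
  rw [mem_Icc, ← sum_map_nsmul_val, ← sum_map_nsmul_val]
  constructor
  · have h1 := sum_map_le_of_le (f := fun a => max (t - a) 0) hℬ fun _ _ => le_max_right _ _
    have h2 : (ℬ.map fun a => t - a).sum ≤ (ℬ.map fun a => max (t - a) 0).sum :=
      Multiset.sum_map_le_sum_map _ _ fun _ _ => le_max_left _ _
    have h3 : (ℬ.map fun a => t - a).sum = t * ℬ.card - ℬ.sum := by
      rw [Multiset.sum_map_sub]
      simp [mul_comm]
    have h4 : t * (α : ℤ) ≤ t * ℬ.card := mul_le_mul_of_nonneg_left (by exact_mod_cast hc) ht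
    linarith
  · have := sum_map_le_of_le (f := fun a => a) hℬ fun a ha =>
      hA a (Multiset.mem_of_mem_nsmul ha)
    simpa using this

theorem sum_Icc_eq_sum_range (a : ℤ) (k : ℕ) (f : ℤ → ℤ) :
    ∑ x ∈ Icc a (a + k - 1), f x = ∑ i ∈ range k, f (a + i) := by
  symm
  refine sum_bij (fun i _ => a + (i : ℤ)) ?_ ?_ ?_ fun _ _ => rfl
  · intro i hi
    rw [mem_range] at hi
    rw [mem_Icc]
    omega
  · intro i _ j _ h
    simpa using h
  · intro x hx
    rw [mem_Icc] at hx
    exact ⟨(x - a).toNat, by rw [mem_range]; omega, by omega⟩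

theorem two_mul_sum_range_add_mul (c d : ℤ) (n : ℕ) :
    2 * ∑ i ∈ range n, (c + d * (i : ℤ)) = 2 * n * c + d * (n * (n - 1)) := by
  induction n with
  | zero => simp
  | succ n ih =>
    rw [sum_range_succ, mul_add, ih]
    push_cast
    ring

/-- The threshold is `a + m - 1`, the `m`-th smallest value, so only the first `m` values contribute
a deficit. -/
theorem card_subseqSums_interval_le {a k r α m : ℕ} (hm1 : 1 ≤ m) (hmk : m ≤ k)
    (hα : α ≤ r * k) :
    ((subseqSums α (interval a (a + k - 1) r)).card : ℚ) ≤
      r * (k * a + (k : ℚ) * (k - 1) / 2) -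
        (((a : ℚ) + m - 1) * α - r * ((m : ℚ) * (m - 1) / 2)) + 1 := by
  have hupper : 2 * ∑ x ∈ Icc (a : ℤ) (a + k - 1), x = 2 * k * a + 1 * (k * (k - 1)) := by
    rw [sum_Icc_eq_sum_range _ _ fun x => x, ← two_mul_sum_range_add_mul]
    simp
  have hlower : 2 * ∑ x ∈ Icc (a : ℤ) (a + k - 1), max ((a : ℤ) + m - 1 - x) 0 = m * (m - 1) := by
    rw [sum_Icc_eq_sum_range _ _ fun x => max ((a : ℤ) + m - 1 - x) 0,
      ← sum_subset (range_subset_range.2 hmk) fun i _ hi => by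
        rw [mem_range] at hi
        omega,
      sum_congr rfl fun (i : ℕ) hi => show max ((a : ℤ) + m - 1 - (a + (i : ℤ))) 0 = ((m : ℤ) - 1) + (-1) * (i : ℤ) by
        rw [mem_range] at hi
        omega,
      two_mul_sum_range_add_mul]
    ring
  have hsub := subseqSums_subset_Icc (r := r) (α := α) (A := Icc (a : ℤ) (a + k - 1))
    (t := (a : ℤ) + m - 1) (fun x hx => by rw [mem_Icc] at hx; omega) (by omega)
  -- Nonemptiness ensures that `Int.toNat` in the cardinality of the enclosing interval does not
  -- truncate.
  have hpos : 0 < (subseqSums α (interval a (a + k - 1) r)).card := by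
    refine (subseqSums_nonempty ?_).card_pos
    rw [interval, Multiset.card_nsmul, card_val, Int.card_Icc]
    convert hα using 2
    omega
  have hle := card_le_card hsub
  rw [Int.card_Icc] at hle
  rw [interval] at hpos ⊢
  have hle' := (Int.le_toNat (Int.pos_iff_toNat_pos.2 (hpos.trans_le hle)).le).1 hle
  qify at hle' hupper hlower
  linear_combination hle' + (r : ℚ) / 2 * hupper + (r : ℚ) / 2 * hlower

theorem isRepeated_nsmul {r : ℕ} (hr : 1 ≤ r) (A : Finset ℤ) :
    IsRepeated A.card r (r • A.val) := by
  refine ⟨by rw [Multiset.toFinset_nsmul _ _ (by omega), val_toFinset], fun a ha => ?_⟩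
  rw [Multiset.count_nsmul, Multiset.count_eq_one_of_mem A.nodup (Multiset.mem_of_mem_nsmul ha),
    mul_one]

theorem isRepeated_interval {r : ℕ} (hr : 1 ≤ r) {a b : ℤ} {k : ℕ} (h : b + 1 - a = k) :
    IsRepeated k r (interval a b r) := by
  have := isRepeated_nsmul hr (Icc a b)
  rwa [Int.card_Icc, h, Int.toNat_natCast] at this

theorem mem_Icc_of_mem_interval {a b x : ℤ} {r : ℕ} (h : x ∈ interval a b r) : a ≤ x ∧ x ≤ b :=
  mem_Icc.1 (Multiset.mem_of_mem_nsmul h)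

theorem interval_inter_negSeq_of_pos {a : ℤ} (ha : 0 < a) (b : ℤ) (r : ℕ) :
    interval a b r ∩ negSeq (interval a b r) = 0 := by
  refine Multiset.eq_zero_of_forall_notMem fun x hx => ?_
  obtain ⟨h1, h2⟩ := Multiset.mem_inter.1 hx
  have h1 := mem_Icc_of_mem_interval h1
  have h2 := mem_Icc_of_mem_interval (mem_negSeq.1 h2)
  omega

theorem interval_zero_inter_negSeq {b : ℤ} (hb : 0 ≤ b) (r : ℕ) :
    interval 0 b r ∩ negSeq (interval 0 b r) = Multiset.replicate r 0 := by
  ext x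
  rcases eq_or_ne x 0 with rfl | hx
  · have h0 : (interval 0 b r).count 0 = r := by
      rw [interval, Multiset.count_nsmul, Multiset.count_eq_one_of_mem (nodup _), mul_one]
      exact left_mem_Icc.2 hb
    have h1 : (negSeq (interval 0 b r)).count 0 = r := by
      have := Multiset.count_map_eq_count' (fun a : ℤ => -a) (interval 0 b r) neg_injective 0
      rwa [neg_zero, h0] at this
    rw [Multiset.count_inter, h0, h1, Multiset.count_replicate_self, min_self]
  · rw [Multiset.count_eq_zero.2, Multiset.count_eq_zero.2]
    · exact fun h => hx (Multiset.eq_of_mem_replicate h)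
    · intro h
      obtain ⟨h1, h2⟩ := Multiset.mem_inter.1 h
      have h1 := mem_Icc_of_mem_interval h1
      have h2 := mem_Icc_of_mem_interval (mem_negSeq.1 h2)
      omega

end SubsequenceSum

theorem theorem3p1 (k r α m : ℕ) (hk : 2 ≤ k) (hr : 1 ≤ r) (hα : α < r * k)
    (hm1 : 1 ≤ m) (hmk : m ≤ k) (hmα : (m - 1) * r ≤ α) (hαm : α < m * r) :
    (∀ 𝒜 : Multiset ℤ, SubsequenceSum.IsRepeated k r 𝒜 →
      𝒜 ∩ SubsequenceSum.negSeq 𝒜 = 0 →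
      ((SubsequenceSum.subseqSums α 𝒜).card : ℚ) ≥
        (r : ℚ) * ((k : ℚ) * (k + 1) / 2 - (m : ℚ) * (m + 1) / 2)
          + (m : ℚ) * ((m : ℚ) * r - α) + 1) ∧
    (∀ 𝒜 : Multiset ℤ, SubsequenceSum.IsRepeated k r 𝒜 →
      𝒜 ∩ SubsequenceSum.negSeq 𝒜 = Multiset.replicate r 0 →
      ((SubsequenceSum.subseqSums α 𝒜).card : ℚ) ≥
        (r : ℚ) * ((k : ℚ) * (k - 1) / 2 - (m : ℚ) * (m - 1) / 2)
          + ((m : ℚ) - 1) * ((m : ℚ) * r - α) + 1) ∧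
    (SubsequenceSum.IsRepeated k r (SubsequenceSum.interval 1 k r) ∧
      SubsequenceSum.interval 1 k r ∩
        SubsequenceSum.negSeq (SubsequenceSum.interval 1 k r) = 0 ∧
      ((SubsequenceSum.subseqSums α (SubsequenceSum.interval 1 k r)).card : ℚ) =
        (r : ℚ) * ((k : ℚ) * (k + 1) / 2 - (m : ℚ) * (m + 1) / 2)
          + (m : ℚ) * ((m : ℚ) * r - α) + 1) ∧
    (SubsequenceSum.IsRepeated k r (SubsequenceSum.interval 0 ((k : ℤ) - 1) r) ∧
      SubsequenceSum.interval 0 ((k : ℤ) - 1) r ∩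
        SubsequenceSum.negSeq (SubsequenceSum.interval 0 ((k : ℤ) - 1) r) =
          Multiset.replicate r 0 ∧
      ((SubsequenceSum.subseqSums α (SubsequenceSum.interval 0 ((k : ℤ) - 1) r)).card : ℚ) =
        (r : ℚ) * ((k : ℚ) * (k - 1) / 2 - (m : ℚ) * (m - 1) / 2)
          + ((m : ℚ) - 1) * ((m : ℚ) * r - α) + 1) := by
  have h1 := SubsequenceSum.isRepeated_interval (a := 1) (b := k) hr (by ring)
  have h0 := SubsequenceSum.isRepeated_interval (a := 0) (b := k - 1) (k := k) hr (by ring)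
  have i1 := SubsequenceSum.interval_inter_negSeq_of_pos one_pos k r
  have i0 := SubsequenceSum.interval_zero_inter_negSeq (b := k - 1) (by omega) r
  refine ⟨fun 𝒜 h𝒜 hneg => SubsequenceSum.le_card_subseqSums h𝒜 hneg hm1 hmk hmα hαm,
    fun 𝒜 h𝒜 hneg => SubsequenceSum.le_card_subseqSums_of_zero h𝒜 hneg hr hm1 hmk hmα hαm,
    ⟨h1, i1, le_antisymm ?_ (SubsequenceSum.le_card_subseqSums h1 i1 hm1 hmk hmα hαm)⟩,
    h0, i0, le_antisymm ?_ (SubsequenceSum.le_card_subseqSums_of_zero h0 i0 hr hm1 hmk hmα hαm)⟩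
  · have := SubsequenceSum.card_subseqSums_interval_le (a := 1) (r := r) hm1 hmk hα.le
    rw [Nat.cast_one, add_sub_cancel_left, Nat.cast_one] at this
    linarith
  · have := SubsequenceSum.card_subseqSums_interval_le (a := 0) (r := r) hm1 hmk hα.le
    rw [Nat.cast_zero, zero_add, Nat.cast_zero] at this
    linarith
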